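/- Throughout, fix a universe $\mathbf{X}$. A \emph{Reedy category} is an $\mathbf{X}$-small category $A$ with two wide (lluf) subcategories $A^{\to}$ (direct) and $A^{\gets}$ (inverse) such that there is a degree function $\deg:\mathrm{Ob}\,A\to\lambda$ to an ordinal $\lambda$ which is strictly raised by every nonidentity morphism of $A^{\to}$ and strictly lowered by every nonidentity morphism of $A^{\gets}$, and such that every morphism of $A$ factors in a unique way as a morphism of $A^{\gets}$ followed by a morphism of $A^{\to}$. A \emph{morphism} $f:A\to B$ of Reedy categories is a functor with $f(A^{\to})\subseteq B^{\to}$ and $f(A^{\gets})\subseteq B^{\gets}$. For any functor $f:A\to B$ and any object $\beta$ of $B$, the comma categories $(f/\beta)$ (objects: pairs $(\alpha, f(\alpha)\to\beta)$) and $(\beta/f)$ (objects: pairs $(\alpha,\beta\to f(\alpha))$) are Reedy categories, a morphism being direct (resp. inverse) when its image in $A$ is so. The terminal category $\star$ is a Reedy category. Let $\mathbf{M}$ be a model $\mathbf{X}$-category: a model category that is locally $\mathbf{X}$-small and has all $\mathbf{X}$-small limits and colimits. In the Reedy model structure on the functor category $\mathbf{M}^A$, the weak equivalences are the objectwise ones;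 a morphism is a cofibration if and only if its restriction to $A^{\to}$ is a projective cofibration (i.e. has the left lifting property with respect to the objectwise trivial fibrations of $\mathbf{M}^{A^{\to}}$) and its restriction to $A^{\gets}$ is an objectwise cofibration; and a morphism is a fibration if and only if its restriction to $A^{\to}$ is an objectwise fibration and its restriction to $A^{\gets}$ is an injective fibration (i.e. has the right lifting property with respect to the objectwise trivial cofibrations of $\mathbf{M}^{A^{\gets}}$). A functor $f:A\to B$ between Reedy categories is a \emph{left fibration} if for every model $\mathbf{X}$-category $\mathbf{M}$ the adjunction $f_!:\mathbf{M}^A\rightleftarrows\mathbf{M}^B:f^{\star}$ is a Quillen adjunction for the Reedy model structures, i.e. the right adjoint $f^{\star}$ (composition with $f$) preserves fibrations and trivial fibrations. It is a \emph{right fibration} if for every model $\mathbf{X}$-category $\mathbf{M}$ the adjunction $f^{\star}:\mathbf{M}^B\rightleftarrows\mathbf{M}^A:f_{\star}$ is a Quillen adjunction, i.e. the left adjoint $f^{\star}$ preserves cofibrations and trivial cofibrations. A Reedy category $A$ is \emph{left} (resp. \emph{right}) \emph{fibrant} if the functor $A\to\star$ is a left (resp. right) fibration; that is, if $\mathrm{colim}:\mathbf{M}^A\rightleftarrows\mathbf{M}:\mathrm{const}$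 (resp. $\mathrm{const}:\mathbf{M}\rightleftarrows\mathbf{M}^A:\lim$) is a Quillen adjunction for every $\mathbf{M}$. \textbf{Lemma.} Let $f:A\to B$ be a morphism of Reedy categories. Then (1) $f$ is a left fibration if and only if, for every object $\beta$ of $B$, the Reedy category $(f/\beta)$ is left fibrant; (2) $f$ is a right fibration if and only if, for every object $\beta$ of $B$, the Reedy category $(\beta/f)$ is right fibrant. -/

import Mathlib

open CategoryTheory Limits HomotopicalAlgebra

universe w v u v' u'

/-! ### Reedy categories -/

/-- A Reedy category: two wide ("lluf") subcategories, given by the multiplicative classes of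
morphisms `inv` (the morphisms of the inverse subcategory `A^←`) and `dir` (the morphisms of the
direct subcategory `A^→`), such that there is a degree function with values in the ordinals, lowered
by the non-identity morphisms of `inv` and raised by those of `dir`, and such that every morphism
factors in a unique way as a morphism of `inv` followed by a morphism of `dir`. -/
class ReedyCategory (A : Type w) [Category.{v} A] where
  /-- the morphisms of the inverse subcategory -/
  inv : MorphismProperty A
  /-- the morphisms of the direct subcategory -/
  dir : MorphismProperty A
  inv_isMultiplicative : inv.IsMultiplicative
  dir_isMultiplicative : dir.IsMultiplicative
  exists_reedyStructure : Nonempty (ReedyStructure inv dir Ordinal.{w})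

namespace ReedyCategory

attribute [instance] inv_isMultiplicative dir_isMultiplicative

/-- The direct subcategory `A^→` of a Reedy category. -/
abbrev Direct (A : Type w) [Category.{v} A] [ReedyCategory A] : Type w :=
  WideSubcategory (dir (A := A))

/-- The inverse subcategory `A^←` of a Reedy category. -/
abbrev Inverse (A : Type w) [Category.{v} A] [ReedyCategory A] : Type w :=
  WideSubcategory (inv (A := A))

/-- The inclusion of the direct subcategory. -/
abbrev directInclusion (A : Type w) [Category.{v} A] [ReedyCategory A] : Direct A ⥤ A :=
  wideSubcategoryInclusion _

/-- The inclusion of the inverse subcategory. -/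
abbrev inverseInclusion (A : Type w) [Category.{v} A] [ReedyCategory A] : Inverse A ⥤ A :=
  wideSubcategoryInclusion _

/-- The terminal Reedy category `⋆`. -/
instance instPUnit : ReedyCategory (Discrete PUnit.{w + 1}) where
  inv := ⊤
  dir := ⊤
  inv_isMultiplicative := inferInstance
  dir_isMultiplicative := inferInstance
  exists_reedyStructure :=
    have hid : ∀ {X Y : Discrete PUnit.{w + 1}} (f : X ⟶ Y), MorphismProperty.identities _ f := by
      rintro ⟨⟨⟩⟩ ⟨⟨⟩⟩ f
      obtain rfl : f = 𝟙 _ := Subsingleton.elim _ _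
      exact ⟨_⟩
    ⟨{ deg := fun _ => 0
       lt₁ := fun f _ hf => (hf (hid f)).elim
       lt₂ := fun f _ hf => (hf (hid f)).elim
       nonempty_unique := by
        rintro X Y f
        refine ⟨⟨⟨⟨X, 𝟙 X, f, by simp, trivial, trivial⟩⟩, ?_⟩⟩
        rintro ⟨Z, i, p, _, _, _⟩
        obtain rfl : Z = X := Subsingleton.elim _ _
        congr 1
        exact Subsingleton.elim _ _ }⟩

/-- For a functor `f : A ⥤ B` whose source is a Reedy category, the comma category `(f/β)` is a
Reedy category: a morphism is direct (resp. inverse) if its image in `A` is so. -/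
instance instCostructuredArrow {A : Type w} [Category.{w} A] [ReedyCategory A]
    {B : Type w} [Category.{w} B] (f : A ⥤ B) (β : B) :
    ReedyCategory (CostructuredArrow f β) where
  inv := inv.inverseImage (CostructuredArrow.proj f β)
  dir := dir.inverseImage (CostructuredArrow.proj f β)
  inv_isMultiplicative := inferInstance
  dir_isMultiplicative := inferInstance
  exists_reedyStructure := by
    obtain ⟨r⟩ := exists_reedyStructure (A := A)
    have hid : ∀ {X Y : CostructuredArrow f β} (g : X ⟶ Y),
        MorphismProperty.identities _ g.left → MorphismProperty.identities _ g := by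
      intro X Y g hg
      obtain ⟨x, ⟨⟨⟩⟩, p⟩ := X
      obtain ⟨y, ⟨⟨⟩⟩, q⟩ := Y
      obtain ⟨g, h, hw⟩ := g
      dsimp at g h hw hg p q
      cases hg
      obtain rfl : q = p := by simpa using hw
      obtain rfl : h = 𝟙 _ := Subsingleton.elim _ _
      exact ⟨CostructuredArrow.mk q⟩
    exact ⟨{
      deg := fun X => r.deg X.left
      lt₁ := fun g hg hg' => r.lt₁ g.left hg (fun h => hg' (hid g h))
      lt₂ := fun g hg hg' => r.lt₂ g.left hg (fun h => hg' (hid g h))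
      nonempty_unique := by
        intro X Y g
        let d := r.mapFactorizationData g.left
        have hd : d.i ≫ d.p = g.left := d.fac
        refine ⟨⟨⟨⟨CostructuredArrow.mk (f.map d.p ≫ Y.hom),
          CostructuredArrow.homMk d.i (by
            rw [CostructuredArrow.mk_hom_eq_self, ← Category.assoc, ← f.map_comp, hd]
            exact CostructuredArrow.w g),
          CostructuredArrow.homMk d.p rfl, by ext; exact hd, d.hi, d.hp⟩⟩, ?_⟩⟩
        rintro ⟨Z, i, p, hip, hi, hp⟩
        have e : (⟨Z.left, i.left, p.left, by rw [← hip]; rfl, hi, hp⟩ :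
            inv.MapFactorizationData dir g.left) = d :=
          (r.subsingleton_mapFactorizationData g.left).elim _ _
        clear_value d
        subst e
        obtain ⟨z, ⟨⟨⟩⟩, q⟩ := Z
        have hq : q = f.map p.left ≫ Y.hom := (CostructuredArrow.w p).symm
        obtain ⟨p, p', pw⟩ := p
        dsimp at p hq
        subst hq
        rfl }⟩

/-- For a functor `f : A ⥤ B` whose source is a Reedy category, the comma category `(β/f)` is a
Reedy category: a morphism is direct (resp. inverse) if its image in `A` is so. -/
instance instStructuredArrow {A : Type w} [Category.{w} A] [ReedyCategory A]
    {B : Type w} [Category.{w} B] (f : A ⥤ B) (β : B) :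
    ReedyCategory (StructuredArrow β f) where
  inv := inv.inverseImage (StructuredArrow.proj β f)
  dir := dir.inverseImage (StructuredArrow.proj β f)
  inv_isMultiplicative := inferInstance
  dir_isMultiplicative := inferInstance
  exists_reedyStructure := by
    obtain ⟨r⟩ := exists_reedyStructure (A := A)
    have hid : ∀ {X Y : StructuredArrow β f} (g : X ⟶ Y),
        MorphismProperty.identities _ g.right → MorphismProperty.identities _ g := by
      intro X Y g hg
      obtain ⟨⟨⟨⟩⟩, x, p⟩ := X
      obtain ⟨⟨⟨⟩⟩, y, q⟩ := Y
      obtain ⟨h, g, hw⟩ := g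
      dsimp at g h hw hg p q
      cases hg
      obtain rfl : q = p := by
        rw [Category.id_comp] at hw
        exact hw.trans ((congrArg _ (f.map_id x)).trans (Category.comp_id _))
      obtain rfl : h = 𝟙 _ := Subsingleton.elim _ _
      exact ⟨StructuredArrow.mk q⟩
    exact ⟨{
      deg := fun X => r.deg X.right
      lt₁ := fun g hg hg' => r.lt₁ g.right hg (fun h => hg' (hid g h))
      lt₂ := fun g hg hg' => r.lt₂ g.right hg (fun h => hg' (hid g h))
      nonempty_unique := by
        intro X Y g
        let d := r.mapFactorizationData g.right
        have hd : d.i ≫ d.p = g.right := d.fac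
        refine ⟨⟨⟨⟨StructuredArrow.mk (X.hom ≫ f.map d.i),
          StructuredArrow.homMk d.i rfl,
          StructuredArrow.homMk d.p (by
            rw [StructuredArrow.mk_hom_eq_self, Category.assoc, ← f.map_comp, hd]
            exact StructuredArrow.w g),
          by ext; exact hd, d.hi, d.hp⟩⟩, ?_⟩⟩
        rintro ⟨Z, i, p, hip, hi, hp⟩
        have e : (⟨Z.right, i.right, p.right, by rw [← hip]; rfl, hi, hp⟩ :
            inv.MapFactorizationData dir g.right) = d :=
          (r.subsingleton_mapFactorizationData g.right).elim _ _
        clear_value d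
        subst e
        obtain ⟨⟨⟨⟩⟩, z, q⟩ := Z
        have hq : q = X.hom ≫ f.map i.right := (StructuredArrow.w i).symm
        obtain ⟨i', i, iw⟩ := i
        change X.right ⟶ z at i
        change q = X.hom ≫ f.map i at hq
        subst hq
        rfl }⟩

/-- A functor between Reedy categories is a morphism of Reedy categories if it restricts to functors
between the direct subcategories and between the inverse subcategories. -/
structure IsMorphism {A : Type u} [Category.{v} A] [ReedyCategory A]
    {B : Type u'} [Category.{v'} B] [ReedyCategory B] (f : A ⥤ B) : Prop where
  map_dir : ∀ ⦃X Y : A⦄ (g : X ⟶ Y), dir g → dir (f.map g)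
  map_inv : ∀ ⦃X Y : A⦄ (g : X ⟶ Y), inv g → inv (f.map g)

end ReedyCategory

/-! ### The Reedy model structure -/

section Reedy

variable (M : Type u) [Category.{v} M] [ModelCategory M]

/-- The cofibrations of the projective model structure on `C ⥤ M` (for a direct category `C`), in
which weak equivalences and fibrations are objectwise: the morphisms with the left lifting property
with respect to the objectwise trivial fibrations. -/
def projectiveCofibrations (C : Type u') [Category.{v'} C] : MorphismProperty (C ⥤ M) :=
  ((trivialFibrations M).functorCategory C).llp

/-- The fibrations of the injective model structure on `C ⥤ M` (for an inverse category `C`), in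
which weak equivalences and cofibrations are objectwise: the morphisms with the right lifting
property with respect to the objectwise trivial cofibrations. -/
def injectiveFibrations (C : Type u') [Category.{v'} C] : MorphismProperty (C ⥤ M) :=
  ((trivialCofibrations M).functorCategory C).rlp

variable (A : Type u') [Category.{v'} A] [ReedyCategory A]

/-- Restriction of diagrams to the direct subcategory. -/
abbrev restrictDirect : (A ⥤ M) ⥤ (ReedyCategory.Direct A ⥤ M) :=
  (Functor.whiskeringLeft _ _ M).obj (ReedyCategory.directInclusion A)

/-- Restriction of diagrams to the inverse subcategory. -/
abbrev restrictInverse : (A ⥤ M) ⥤ (ReedyCategory.Inverse A ⥤ M) :=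
  (Functor.whiskeringLeft _ _ M).obj (ReedyCategory.inverseInclusion A)

/-- The Reedy weak equivalences: the objectwise weak equivalences. -/
instance reedyWeakEquivalences : CategoryWithWeakEquivalences (A ⥤ M) where
  weakEquivalences := (weakEquivalences M).functorCategory A

/-- The Reedy cofibrations: the morphisms whose restriction to the direct subcategory is a
projective cofibration, and whose restriction to the inverse subcategory is an injective (that is,
objectwise) cofibration. -/
instance reedyCofibrations : CategoryWithCofibrations (A ⥤ M) where
  cofibrations :=
    (projectiveCofibrations M (ReedyCategory.Direct A)).inverseImage (restrictDirect M A) ⊓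
    ((cofibrations M).functorCategory (ReedyCategory.Inverse A)).inverseImage (restrictInverse M A)

/-- The Reedy fibrations: the morphisms whose restriction to the direct subcategory is a projective
(that is, objectwise) fibration, and whose restriction to the inverse subcategory is an injective
fibration. -/
instance reedyFibrations : CategoryWithFibrations (A ⥤ M) where
  fibrations :=
    ((fibrations M).functorCategory (ReedyCategory.Direct A)).inverseImage (restrictDirect M A) ⊓
    (injectiveFibrations M (ReedyCategory.Inverse A)).inverseImage (restrictInverse M A)

end Reedy

/-! ### Quillen functors, left and right fibrations -/

section Quillen

variable {C : Type u} [Category.{v} C] [CategoryWithWeakEquivalences C]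
  [CategoryWithCofibrations C] [CategoryWithFibrations C]
  {D : Type u'} [Category.{v'} D] [CategoryWithWeakEquivalences D]
  [CategoryWithCofibrations D] [CategoryWithFibrations D]

/-- `G` is a right Quillen functor, i.e. the right adjoint of a Quillen adjunction: it has a left
adjoint, and preserves fibrations and trivial fibrations. -/
structure IsRightQuillen (G : C ⥤ D) : Prop where
  isRightAdjoint : G.IsRightAdjoint
  fibrations_map : ∀ ⦃X Y : C⦄ (p : X ⟶ Y), fibrations C p → fibrations D (G.map p)
  trivialFibrations_map :
    ∀ ⦃X Y : C⦄ (p : X ⟶ Y), trivialFibrations C p → trivialFibrations D (G.map p)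

/-- `F` is a left Quillen functor, i.e. the left adjoint of a Quillen adjunction: it has a right
adjoint, and preserves cofibrations and trivial cofibrations. -/
structure IsLeftQuillen (F : C ⥤ D) : Prop where
  isLeftAdjoint : F.IsLeftAdjoint
  cofibrations_map : ∀ ⦃X Y : C⦄ (i : X ⟶ Y), cofibrations C i → cofibrations D (F.map i)
  trivialCofibrations_map :
    ∀ ⦃X Y : C⦄ (i : X ⟶ Y), trivialCofibrations C i → trivialCofibrations D (F.map i)

end Quillen

namespace ReedyCategory

variable {A B : Type w} [SmallCategory A] [SmallCategory B] [ReedyCategory A] [ReedyCategory B]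

/-- `f : A ⥤ B` is a left fibration: for every locally small, complete and cocomplete model category
`M`, the adjunction `f_! ⊣ f^⋆` between the Reedy model categories `A ⥤ M` and `B ⥤ M` is a Quillen
adjunction, i.e. composition with `f` is a right Quillen functor. -/
def IsLeftFibration (f : A ⥤ B) : Prop :=
  ∀ (M : Type (max u (w + 1))) [Category.{w} M] [ModelCategory M]
    [HasLimitsOfSize.{w, w} M] [HasColimitsOfSize.{w, w} M],
    IsRightQuillen ((Functor.whiskeringLeft A B M).obj f)

/-- `f : A ⥤ B` is a right fibration: for every locally small, complete and cocomplete model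
category `M`, the adjunction `f^⋆ ⊣ f_⋆` between the Reedy model categories `B ⥤ M` and `A ⥤ M` is a
Quillen adjunction, i.e. composition with `f` is a left Quillen functor. -/
def IsRightFibration (f : A ⥤ B) : Prop :=
  ∀ (M : Type (max u (w + 1))) [Category.{w} M] [ModelCategory M]
    [HasLimitsOfSize.{w, w} M] [HasColimitsOfSize.{w, w} M],
    IsLeftQuillen ((Functor.whiskeringLeft A B M).obj f)

variable (A)

/-- `A` is left fibrant: the morphism `A ⥤ ⋆` is a left fibration (so `colim ⊣ const` is Quillen). -/
def IsLeftFibrant : Prop := IsLeftFibration.{w, u} (Functor.star.{w} A)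

/-- `A` is right fibrant: the morphism `A ⥤ ⋆` is a right fibration (so `const ⊣ lim` is
Quillen). -/
def IsRightFibrant : Prop := IsRightFibration.{w, u} (Functor.star.{w} A)

end ReedyCategory

/-! Both halves reduce to a condition on categories that does not mention model structures. Call it
a compatible choice: each object `e` receives a morphism `x ⟶ e` whose composites with all morphisms
`e ⟶ e'` are again the chosen ones. The source `x` is then constant on each connected component. In
a direct category endomorphisms are identities, so `x` is initial in its component. The claim behind
(2) is that `f` is a right fibration exactly when every `(β/f)^→` has such a choice; (1) is dual,
with terminal objects in the components of `(f/β)^←`.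

Sufficiency. Composition with `f` preserves objectwise weak equivalences and objectwise
cofibrations, so only projective cofibrations on the direct part matter. By adjunction these are
preserved once the right Kan extension along `A^→ ⥤ B^→` preserves objectwise trivial fibrations.
That extension is a limit over the categories `(β/f^→)`, and a compatible choice there lets lifting
problems be solved at the chosen sources and pushed forward. Since `(β/f^→)` sits inside `(β/f)^→`
and is closed under passing to sources, it inherits the choice.

Necessity. One model category suffices: sets with injections, surjections, and all maps as weak
equivalences (for (1), its opposite). By unique factorization `Hom(β,-)` is Reedy cofibrant. If `f`
is a right fibration, `Hom(β,f-)` is projective on `A^→`, so the canonical surjection onto it from a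
coproduct of corepresentables splits; a section is a compatible choice.

The lemma follows because applying the criterion to `(β/f) ⥤ ⋆` gives the same condition on
`(β/f)^→`. -/

section Kan

/-! ### Lifting properties and pointwise Kan extensions. -/

lemma hasLiftingProperty_of_isColimit {J : Type u'} [Category.{v'} J]
    {M : Type u} [Category.{v} M] {K L : J ⥤ M} (i : K ⟶ L) {X Y : M} (p : X ⟶ Y)
    [HasLiftingProperty i ((Functor.const J).map p)] {cK : Cocone K} (hK : IsColimit cK)
    {cL : Cocone L} (hL : IsColimit cL) (φ : cK.pt ⟶ cL.pt)
    (hφ : ∀ j, cK.ι.app j ≫ φ = i.app j ≫ cL.ι.app j) : HasLiftingProperty φ p where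
  sq_hasLift {u v} sq := by
    have sq' : CommSq (cK.ι ≫ (Functor.const J).map u) i ((Functor.const J).map p)
        (cL.ι ≫ (Functor.const J).map v) := ⟨by
      ext j
      simp [sq.w, reassoc_of% hφ]⟩
    have hl (j : J) : i.app j ≫ sq'.lift.app j = cK.ι.app j ≫ u :=
      NatTrans.congr_app sq'.fac_left j
    have hr (j : J) : sq'.lift.app j ≫ p = cL.ι.app j ≫ v :=
      NatTrans.congr_app sq'.fac_right j
    have hd (j : J) : cL.ι.app j ≫ hL.desc (Cocone.mk X sq'.lift) = sq'.lift.app j :=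
      hL.fac _ j
    exact ⟨⟨⟨hL.desc (Cocone.mk X sq'.lift),
      hK.hom_ext fun j => by rw [reassoc_of% hφ, hd, hl],
      hL.hom_ext fun j => by rw [reassoc_of% hd, hr]⟩⟩⟩

lemma hasLiftingProperty_of_isLimit {J : Type u'} [Category.{v'} J]
    {M : Type u} [Category.{v} M] {K L : J ⥤ M} (p : K ⟶ L) {X Y : M} (i : X ⟶ Y)
    [HasLiftingProperty ((Functor.const J).map i) p] {cK : Cone K} (hK : IsLimit cK)
    {cL : Cone L} (hL : IsLimit cL) (φ : cK.pt ⟶ cL.pt)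
    (hφ : ∀ j, φ ≫ cL.π.app j = cK.π.app j ≫ p.app j) : HasLiftingProperty i φ where
  sq_hasLift {u v} sq := by
    have sq' : CommSq ((Functor.const J).map u ≫ cK.π) ((Functor.const J).map i) p
        ((Functor.const J).map v ≫ cL.π) := ⟨by
      ext j
      simp [← sq.w_assoc, hφ]⟩
    have hl (j : J) : i ≫ sq'.lift.app j = u ≫ cK.π.app j :=
      NatTrans.congr_app sq'.fac_left j
    have hr (j : J) : sq'.lift.app j ≫ p.app j = v ≫ cL.π.app j :=
      NatTrans.congr_app sq'.fac_right j
    have hd (j : J) : hK.lift (Cone.mk Y sq'.lift) ≫ cK.π.app j = sq'.lift.app j :=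
      hK.fac _ j
    exact ⟨⟨⟨hK.lift (Cone.mk Y sq'.lift),
      hK.hom_ext fun j => by rw [Category.assoc, hd, hl],
      hL.hom_ext fun j => by rw [Category.assoc, hφ, reassoc_of% hd, hr]⟩⟩⟩

variable {C D : Type w} [SmallCategory C] [SmallCategory D]
  {M : Type u} [Category.{w} M]

/-- If constant diagrams on the comma categories `(g/d)` carry `R` into the morphisms with the right
lifting property against objectwise `R.llp`, then the left Kan extension along `g` preserves
objectwise `R.llp`. -/
lemma functorCategory_lan_map [HasColimitsOfSize.{w, w} M] (R : MorphismProperty M) (g : C ⥤ D)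
    (hg : ∀ (d : D) ⦃X Y : M⦄ (p : X ⟶ Y), R p →
      (R.llp.functorCategory (CostructuredArrow g d)).rlp ((Functor.const _).map p))
    {K L : C ⥤ M} (i : K ⟶ L) (hi : R.llp.functorCategory C i) :
    R.llp.functorCategory D (g.lan.map i) := by
  intro d X Y p hp
  have := hg d p hp (Functor.whiskerLeft (CostructuredArrow.proj g d) i) (fun c => hi c.left)
  refine hasLiftingProperty_of_isColimit (Functor.whiskerLeft (CostructuredArrow.proj g d) i) p
    (g.isPointwiseLeftKanExtensionLeftKanExtensionUnit K d)
    (g.isPointwiseLeftKanExtensionLeftKanExtensionUnit L d) ((g.lan.map i).app d) fun c => ?_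
  have h1 : (g.lanUnit.app K).app c.left ≫ (g.lan.map i).app (g.obj c.left) =
      i.app c.left ≫ (g.lanUnit.app L).app c.left :=
    (NatTrans.congr_app (g.lanUnit.naturality i) c.left).symm
  have h2 := (g.lan.map i).naturality c.hom
  change ((g.lanUnit.app K).app c.left ≫ (g.lan.obj K).map c.hom) ≫ (g.lan.map i).app d =
    i.app c.left ≫ (g.lanUnit.app L).app c.left ≫ (g.lan.obj L).map c.hom
  refine (Category.assoc _ _ _).trans ((congrArg _ h2).trans ?_)
  exact (Category.assoc _ _ _).symm.trans ((congrArg (· ≫ _) h1).trans (Category.assoc _ _ _))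

/-- Transposing along the adjunction between left Kan extension and restriction turns the lifting
problem into one for `g.lan.map i`, which is still objectwise in `R.llp`. -/
lemma rlp_functorCategory_whiskerLeft [HasColimitsOfSize.{w, w} M] (R : MorphismProperty M)
    (g : C ⥤ D)
    (hg : ∀ (d : D) ⦃X Y : M⦄ (p : X ⟶ Y), R p →
      (R.llp.functorCategory (CostructuredArrow g d)).rlp ((Functor.const _).map p))
    {X Y : D ⥤ M} (q : X ⟶ Y) (hq : (R.llp.functorCategory D).rlp q) :
    (R.llp.functorCategory C).rlp (Functor.whiskerLeft g q) := by
  intro K L i hi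
  have := hq _ (functorCategory_lan_map R g hg i hi)
  exact ((g.lanAdjunction M).hasLiftingProperty_iff i q).1 this

/-- If constant diagrams on the comma categories `(d/g)` carry `R` into the morphisms with the left
lifting property against objectwise `R.rlp`, then the right Kan extension along `g` preserves
objectwise `R.rlp`. -/
lemma functorCategory_ran_map [HasLimitsOfSize.{w, w} M] (R : MorphismProperty M) (g : C ⥤ D)
    (hg : ∀ (d : D) ⦃X Y : M⦄ (i : X ⟶ Y), R i →
      (R.rlp.functorCategory (StructuredArrow d g)).llp ((Functor.const _).map i))
    {K L : C ⥤ M} (p : K ⟶ L) (hp : R.rlp.functorCategory C p) :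
    R.rlp.functorCategory D (g.ran.map p) := by
  intro d X Y i hi
  have := hg d i hi (Functor.whiskerLeft (StructuredArrow.proj d g) p) (fun c => hp c.right)
  refine hasLiftingProperty_of_isLimit (Functor.whiskerLeft (StructuredArrow.proj d g) p) i
    (g.isPointwiseRightKanExtensionRanCounit K d)
    (g.isPointwiseRightKanExtensionRanCounit L d) ((g.ran.map p).app d) fun c => ?_
  have h1 : (g.ran.map p).app (g.obj c.right) ≫ (g.ranCounit.app L).app c.right =
      (g.ranCounit.app K).app c.right ≫ p.app c.right :=
    NatTrans.congr_app (g.ranCounit.naturality p) c.right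
  have h2 := (g.ran.map p).naturality c.hom
  change (g.ran.map p).app d ≫ (g.ran.obj L).map c.hom ≫ (g.ranCounit.app L).app c.right =
    ((g.ran.obj K).map c.hom ≫ (g.ranCounit.app K).app c.right) ≫ p.app c.right
  refine (Category.assoc _ _ _).symm.trans ((congrArg (· ≫ _) h2.symm).trans ?_)
  exact (Category.assoc _ _ _).trans ((congrArg _ h1).trans (Category.assoc _ _ _).symm)

lemma llp_functorCategory_whiskerLeft [HasLimitsOfSize.{w, w} M] (R : MorphismProperty M)
    (g : C ⥤ D)
    (hg : ∀ (d : D) ⦃X Y : M⦄ (i : X ⟶ Y), R i →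
      (R.rlp.functorCategory (StructuredArrow d g)).llp ((Functor.const _).map i))
    {X Y : D ⥤ M} (q : X ⟶ Y) (hq : (R.rlp.functorCategory D).llp q) :
    (R.rlp.functorCategory C).llp (Functor.whiskerLeft g q) := by
  intro K L p hp
  have := hq _ (functorCategory_ran_map R g hg p hp)
  exact ((g.ranAdjunction M).hasLiftingProperty_iff q p).2 this

end Kan

/-! ### Compatible choices of slices. -/

section Slices

/-- A category in which every object `e` is the target of a chosen morphism, such that all
morphisms are compatible with these choices. -/
def HasCompatibleOver (E : Type u) [Category.{v} E] : Prop :=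
  ∃ r : ∀ e : E, Over e, ∀ ⦃e e' : E⦄ (k : e ⟶ e'), r e' = Over.mk ((r e).hom ≫ k)

/-- A category in which every object `e` is the source of a chosen morphism, such that all
morphisms are compatible with these choices. -/
def HasCompatibleUnder (E : Type u) [Category.{v} E] : Prop :=
  ∃ r : ∀ e : E, Under e, ∀ ⦃e e' : E⦄ (k : e ⟶ e'), r e = Under.mk (k ≫ (r e').hom)

variable {E : Type u} [Category.{v} E] {E' : Type u'} [Category.{v'} E']

/-- A choice over `ι.obj e` is transported back by `Φ`; compatibility of `Φ` with postcomposition is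
all that is needed, so `ι` may be an inclusion closed under sources. -/
lemma HasCompatibleOver.of_functor (h : HasCompatibleOver E) (ι : E' ⥤ E)
    (Φ : ∀ e, Over (ι.obj e) → Over e)
    (hΦ : ∀ ⦃e e' : E'⦄ (k : e ⟶ e') (o : Over (ι.obj e)),
      Φ e' (Over.mk (o.hom ≫ ι.map k)) = Over.mk ((Φ e o).hom ≫ k)) : HasCompatibleOver E' := by
  obtain ⟨r, hr⟩ := h
  exact ⟨fun e => Φ e (r (ι.obj e)), fun e e' k => by dsimp only; rw [hr (ι.map k), hΦ]⟩

lemma HasCompatibleUnder.of_functor (h : HasCompatibleUnder E) (ι : E' ⥤ E)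
    (Φ : ∀ e, Under (ι.obj e) → Under e)
    (hΦ : ∀ ⦃e e' : E'⦄ (k : e ⟶ e') (o : Under (ι.obj e')),
      Φ e (Under.mk (ι.map k ≫ o.hom)) = Under.mk (k ≫ (Φ e' o).hom)) : HasCompatibleUnder E' := by
  obtain ⟨r, hr⟩ := h
  exact ⟨fun e => Φ e (r (ι.obj e)), fun e e' k => by dsimp only; rw [hr (ι.map k), hΦ]⟩

variable {M : Type w} [Category.{v'} M] (R : MorphismProperty M)

lemma HasCompatibleOver.llp_const_map (h : HasCompatibleOver E) {X Y : M} (i : X ⟶ Y) (hi : R i) :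
    (R.rlp.functorCategory E).llp ((Functor.const E).map i) := by
  obtain ⟨r, hr⟩ := h
  intro K L p hp
  refine ⟨fun {u v} sq => ?_⟩
  have hsq (e : E) : CommSq (u.app e) i (p.app e) (v.app e) := ⟨NatTrans.congr_app sq.w e⟩
  have := fun e => hp e i hi
  -- Solve the lifting problem at the source of the chosen morphism and push the result forward to
  -- `e`. Naturality holds because the source does not change along `k`.
  refine ⟨⟨⟨{ app e := (hsq (r e).left).lift ≫ K.map (r e).hom, naturality e e' k := ?_ }, ?_, ?_⟩⟩⟩
  · rw [hr k]
    simp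
  · ext e
    simpa using (u.naturality (r e).hom).symm
  · ext e
    simpa using (v.naturality (r e).hom).symm

lemma HasCompatibleUnder.rlp_const_map (h : HasCompatibleUnder E) {X Y : M} (p : X ⟶ Y)
    (hp : R p) : (R.llp.functorCategory E).rlp ((Functor.const E).map p) := by
  obtain ⟨r, hr⟩ := h
  intro K L i hi
  refine ⟨fun {u v} sq => ?_⟩
  have hsq (e : E) : CommSq (u.app e) (i.app e) p (v.app e) := ⟨NatTrans.congr_app sq.w e⟩
  have := fun e => hi e p hp
  -- Dually, move to the target of the chosen morphism and lift there.
  refine ⟨⟨⟨{ app e := L.map (r e).hom ≫ (hsq (r e).right).lift, naturality e e' k := ?_ },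
    ?_, ?_⟩⟩⟩
  · rw [hr k]
    simp
  · ext e
    simp [← i.naturality_assoc]
  · ext e
    simp

end Slices

/-! ### Cancellation in Reedy categories, and induced functors. -/

namespace ReedyCategory

section

variable {A : Type u} [Category.{v} A] [ReedyCategory A]

lemma subsingleton_mapFactorizationData {X Y : A} (g : X ⟶ Y) :
    Subsingleton ((inv (A := A)).MapFactorizationData dir g) :=
  exists_reedyStructure.some.subsingleton_mapFactorizationData g

/-- The Reedy factorization of a morphism. -/
noncomputable def factorization {X Y : A} (g : X ⟶ Y) :
    (inv (A := A)).MapFactorizationData dir g :=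
  exists_reedyStructure.some.mapFactorizationData g

/-- The factorization of `b`, precomposed with `a`, and `a ≫ b` followed by an identity are two
Reedy factorizations of `a ≫ b`. By uniqueness the direct part of `b` is an identity. -/
lemma inv_of_precomp {X Y Z : A} (a : X ⟶ Y) (b : Y ⟶ Z) (ha : inv a) (hab : inv (a ≫ b)) :
    inv b := by
  have hb := (factorization b).fac
  have e := (subsingleton_mapFactorizationData (a ≫ b)).elim
    ⟨Z, a ≫ b, 𝟙 Z, by simp, hab, MorphismProperty.id_mem _ _⟩
    ⟨_, a ≫ (factorization b).i, (factorization b).p, by simp,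
      MorphismProperty.comp_mem _ _ _ ha (factorization b).hi, (factorization b).hp⟩
  rw [← hb]
  -- The two data have different middle objects, so the conclusion is proved for a variable `d` and
  -- the equality eliminated.
  have h : ∀ d : (inv (A := A)).MapFactorizationData dir (a ≫ b),
      ⟨Z, a ≫ b, 𝟙 Z, by simp, hab, MorphismProperty.id_mem _ _⟩ = d → inv d.p := by
    rintro _ rfl
    exact MorphismProperty.id_mem _ _
  exact MorphismProperty.comp_mem _ _ _ (factorization b).hi (h _ e)

lemma dir_of_postcomp {X Y Z : A} (a : X ⟶ Y) (b : Y ⟶ Z) (hb : dir b) (hab : dir (a ≫ b)) :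
    dir a := by
  have ha := (factorization a).fac
  have e := (subsingleton_mapFactorizationData (a ≫ b)).elim
    ⟨X, 𝟙 X, a ≫ b, by simp, MorphismProperty.id_mem _ _, hab⟩
    ⟨_, (factorization a).i, (factorization a).p ≫ b, by simp, (factorization a).hi,
      MorphismProperty.comp_mem _ _ _ (factorization a).hp hb⟩
  rw [← ha]
  have h : ∀ d : (inv (A := A)).MapFactorizationData dir (a ≫ b),
      ⟨X, 𝟙 X, a ≫ b, by simp, MorphismProperty.id_mem _ _, hab⟩ = d → dir d.i := by
    rintro _ rfl
    exact MorphismProperty.id_mem _ _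
  exact MorphismProperty.comp_mem _ _ _ (h _ e) (factorization a).hp

variable {B : Type u'} [Category.{v'} B] [ReedyCategory B] {f : A ⥤ B}

/-- The functor between direct subcategories induced by a morphism of Reedy categories. -/
def IsMorphism.mapDirect (hf : IsMorphism f) : Direct A ⥤ Direct B where
  obj a := ⟨f.obj a.obj⟩
  map g := ⟨f.map g.hom, hf.map_dir _ g.property⟩
  map_id _ := WideSubcategory.hom_ext _ (f.map_id _)
  map_comp _ _ := WideSubcategory.hom_ext _ (f.map_comp _ _)

/-- The functor between inverse subcategories induced by a morphism of Reedy categories. -/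
def IsMorphism.mapInverse (hf : IsMorphism f) : Inverse A ⥤ Inverse B where
  obj a := ⟨f.obj a.obj⟩
  map g := ⟨f.map g.hom, hf.map_inv _ g.property⟩
  map_id _ := WideSubcategory.hom_ext _ (f.map_id _)
  map_comp _ _ := WideSubcategory.hom_ext _ (f.map_comp _ _)

variable (A) in
lemma isMorphism_star : IsMorphism (Functor.star.{w} A) :=
  ⟨fun _ _ _ _ => trivial, fun _ _ _ _ => trivial⟩

end

/-! ### Sufficiency of the criterion, and comparison of comma categories. -/

section

variable {A B : Type w} [SmallCategory A] [SmallCategory B] [ReedyCategory A] [ReedyCategory B]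
  {f : A ⥤ B}

lemma isRightFibration_of_hasCompatibleOver (hf : IsMorphism f)
    (h : ∀ β : B, HasCompatibleOver (StructuredArrow (⟨β⟩ : Direct B) hf.mapDirect)) :
    IsRightFibration.{w, u} f := by
  intro M _ _ _ _
  have h1 ⦃X Y : B ⥤ M⦄ (i : X ⟶ Y) (hi : cofibrations (B ⥤ M) i) :
      cofibrations (A ⥤ M) (((Functor.whiskeringLeft A B M).obj f).map i) := by
    -- The inverse half is objectwise, hence inherited; only projective cofibrancy on `A^→` remains.
    refine ⟨?_, fun a => hi.2 ⟨f.obj a.obj⟩⟩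
    have := llp_functorCategory_whiskerLeft (cofibrations M) hf.mapDirect
      (fun b X Y i hi => (h b.obj).llp_const_map _ i hi) ((restrictDirect M B).map i)
    rw [cofibrations_rlp] at this
    exact this hi.1
  exact ⟨(f.ranAdjunction M).isLeftAdjoint, h1, fun X Y i hi => ⟨h1 i hi.1, fun a => hi.2 (f.obj a)⟩⟩

lemma isLeftFibration_of_hasCompatibleUnder (hf : IsMorphism f)
    (h : ∀ β : B, HasCompatibleUnder (CostructuredArrow hf.mapInverse (⟨β⟩ : Inverse B))) :
    IsLeftFibration.{w, u} f := by
  intro M _ _ _ _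
  have h1 ⦃X Y : B ⥤ M⦄ (p : X ⟶ Y) (hp : fibrations (B ⥤ M) p) :
      fibrations (A ⥤ M) (((Functor.whiskeringLeft A B M).obj f).map p) := by
    refine ⟨fun a => hp.1 ⟨f.obj a.obj⟩, ?_⟩
    have := rlp_functorCategory_whiskerLeft (fibrations M) hf.mapInverse
      (fun b X Y i hi => (h b.obj).rlp_const_map _ i hi) ((restrictInverse M B).map p)
    rw [fibrations_llp] at this
    exact this hp.2
  exact ⟨(f.lanAdjunction M).isRightAdjoint, h1,
    fun X Y i hi => ⟨h1 i hi.1, fun a => hi.2 (f.obj a)⟩⟩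

lemma isRightFibrant_of_hasCompatibleOver (h : HasCompatibleOver (Direct A)) :
    IsRightFibrant.{w, u} A := by
  refine isRightFibration_of_hasCompatibleOver (isMorphism_star A) fun β =>
    h.of_functor (StructuredArrow.proj _ _)
      (fun e o => Over.mk (StructuredArrow.homMk (f := StructuredArrow.mk
        (⟨eqToHom (Subsingleton.elim _ _), trivial⟩ :
          (⟨β⟩ : Direct _) ⟶ (isMorphism_star A).mapDirect.obj o.left)) o.hom ?_)) ?_
  · exact WideSubcategory.hom_ext _ (Subsingleton.elim _ _)
  · intros; rfl

lemma isLeftFibrant_of_hasCompatibleUnder (h : HasCompatibleUnder (Inverse A)) :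
    IsLeftFibrant.{w, u} A := by
  refine isLeftFibration_of_hasCompatibleUnder (isMorphism_star A) fun β =>
    h.of_functor (CostructuredArrow.proj _ _)
      (fun e o => Under.mk (CostructuredArrow.homMk (f' := CostructuredArrow.mk
        (⟨eqToHom (Subsingleton.elim _ _), trivial⟩ :
          (isMorphism_star A).mapInverse.obj o.right ⟶ (⟨β⟩ : Inverse _))) o.hom ?_)) ?_
  · exact WideSubcategory.hom_ext _ (Subsingleton.elim _ _)
  · intros; rfl

lemma hasCompatibleOver_of_structuredArrow_star (x : Discrete PUnit.{w + 1})
    (h : HasCompatibleOver (Direct (StructuredArrow x (Functor.star.{w} A)))) :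
    HasCompatibleOver (Direct A) :=
  h.of_functor
    { obj a := ⟨StructuredArrow.mk (Y := a.obj) (eqToHom (Subsingleton.elim _ _))⟩
      map k := ⟨StructuredArrow.homMk k.hom (Subsingleton.elim _ _), k.property⟩ }
    (fun a o => Over.mk (Y := (⟨o.left.obj.right⟩ : Direct A)) ⟨o.hom.hom.right, o.hom.property⟩)
    (fun _ _ _ _ => rfl)

lemma hasCompatibleUnder_of_costructuredArrow_star (x : Discrete PUnit.{w + 1})
    (h : HasCompatibleUnder (Inverse (CostructuredArrow (Functor.star.{w} A) x))) :
    HasCompatibleUnder (Inverse A) :=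
  h.of_functor
    { obj a := ⟨CostructuredArrow.mk (Y := a.obj) (eqToHom (Subsingleton.elim _ _))⟩
      map k := ⟨CostructuredArrow.homMk k.hom (Subsingleton.elim _ _), k.property⟩ }
    (fun a o => Under.mk (Y := (⟨o.right.obj.left⟩ : Inverse A)) ⟨o.hom.hom.left, o.hom.property⟩)
    (fun _ _ _ _ => rfl)

/-- The functor `(β/f^→) ⥤ (β/f)^→`. -/
def IsMorphism.structuredArrowToDirect (hf : IsMorphism f) (β : B) :
    StructuredArrow (⟨β⟩ : Direct B) hf.mapDirect ⥤ Direct (StructuredArrow β f) where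
  obj e := ⟨StructuredArrow.mk (Y := e.right.obj) (f := e.hom.hom)⟩
  map k := ⟨StructuredArrow.homMk k.right.hom
    (congrArg InducedWideCategory.Hom.hom (StructuredArrow.w k)), k.right.property⟩

/-- The functor `(f^←/β) ⥤ (f/β)^←`. -/
def IsMorphism.costructuredArrowToInverse (hf : IsMorphism f) (β : B) :
    CostructuredArrow hf.mapInverse (⟨β⟩ : Inverse B) ⥤ Inverse (CostructuredArrow f β) where
  obj e := ⟨CostructuredArrow.mk (Y := e.left.obj) (f := e.hom.hom)⟩
  map k := ⟨CostructuredArrow.homMk k.left.hom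
    (congrArg InducedWideCategory.Hom.hom (CostructuredArrow.w k)), k.left.property⟩

/-- An object of `(β/f)^→` mapping to one whose structure map is direct has a direct structure map
itself, by cancellation. The chosen sources therefore stay in `(β/f^→)`. -/
lemma hasCompatibleOver_structuredArrow_mapDirect (hf : IsMorphism f) (β : B)
    (h : HasCompatibleOver (Direct (StructuredArrow β f))) :
    HasCompatibleOver (StructuredArrow (⟨β⟩ : Direct B) hf.mapDirect) := by
  have hw (e) (o : Over ((hf.structuredArrowToDirect β).obj e)) :
      o.left.obj.hom ≫ f.map o.hom.hom.right = e.hom.hom := StructuredArrow.w o.hom.hom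
  have hdir (e) (o : Over ((hf.structuredArrowToDirect β).obj e)) : dir o.left.obj.hom :=
    dir_of_postcomp _ _ (hf.map_dir _ o.hom.property) (by
      have he := e.hom.property
      rwa [← hw e o] at he)
  exact h.of_functor (hf.structuredArrowToDirect β)
    (fun e o => Over.mk (StructuredArrow.homMk
      (f := StructuredArrow.mk (Y := (⟨o.left.obj.right⟩ : Direct A))
        (⟨o.left.obj.hom, hdir e o⟩ : (⟨β⟩ : Direct B) ⟶ hf.mapDirect.obj ⟨o.left.obj.right⟩))
      ⟨o.hom.hom.right, o.hom.property⟩ (by exact WideSubcategory.hom_ext _ (hw e o))))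
    (fun _ _ _ _ => rfl)

lemma hasCompatibleUnder_costructuredArrow_mapInverse (hf : IsMorphism f) (β : B)
    (h : HasCompatibleUnder (Inverse (CostructuredArrow f β))) :
    HasCompatibleUnder (CostructuredArrow hf.mapInverse (⟨β⟩ : Inverse B)) := by
  have hw (e) (o : Under ((hf.costructuredArrowToInverse β).obj e)) :
      f.map o.hom.hom.left ≫ o.right.obj.hom = e.hom.hom := CostructuredArrow.w o.hom.hom
  have hinv (e) (o : Under ((hf.costructuredArrowToInverse β).obj e)) : inv o.right.obj.hom :=
    inv_of_precomp _ _ (hf.map_inv _ o.hom.property) (by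
      have he := e.hom.property
      rwa [← hw e o] at he)
  exact h.of_functor (hf.costructuredArrowToInverse β)
    (fun e o => Under.mk (CostructuredArrow.homMk
      (f' := CostructuredArrow.mk (Y := (⟨o.right.obj.left⟩ : Inverse A))
        (⟨o.right.obj.hom, hinv e o⟩ : hf.mapInverse.obj ⟨o.right.obj.left⟩ ⟶ (⟨β⟩ : Inverse B)))
      ⟨o.hom.hom.left, o.hom.property⟩ (by exact WideSubcategory.hom_ext _ (hw e o))))
    (fun _ _ _ _ => rfl)

end

end ReedyCategory

/-! ### The model category of sets with injections and surjections. -/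

section SetModel

set_option linter.checkUnivs false in
/-- The category of `w`-small types, with objects lifted to a larger universe. -/
structure LargeType : Type (max u (w + 1)) where
  /-- the underlying type -/
  carrier : ULift.{u} (Type w)

namespace LargeType

/-- The object of `LargeType` attached to a type. -/
def of (X : Type w) : LargeType.{w, u} := ⟨⟨X⟩⟩

instance : CoeSort LargeType.{w, u} (Type w) := ⟨fun X => X.carrier.down⟩

instance : Category.{w} LargeType.{w, u} where
  Hom X Y := X → Y
  id _ := id
  comp f g := g ∘ f

/-- `LargeType` is equivalent to the category of types. -/
def functor : LargeType.{w, u} ⥤ Type w where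
  obj X := X
  map f := TypeCat.ofHom f

instance : functor.{w, u}.Faithful where
  map_injective h := by
    funext x
    exact ConcreteCategory.congr_hom h x

instance : functor.{w, u}.Full where
  map_surjective f := ⟨fun x => f x, rfl⟩

instance : functor.{w, u}.EssSurj where
  mem_essImage X := ⟨of X, ⟨Iso.refl _⟩⟩

instance : functor.{w, u}.IsEquivalence where

instance : HasLimitsOfSize.{w, w} LargeType.{w, u} :=
  Adjunction.has_limits_of_equivalence functor

instance : HasColimitsOfSize.{w, w} LargeType.{w, u} :=
  Adjunction.has_colimits_of_equivalence functor

instance : CategoryWithWeakEquivalences LargeType.{w, u} := ⟨⊤⟩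

instance : CategoryWithCofibrations LargeType.{w, u} := ⟨fun X Y f => Function.Injective (f : X → Y)⟩

instance : CategoryWithFibrations LargeType.{w, u} := ⟨fun X Y f => Function.Surjective (f : X → Y)⟩

lemma hasLiftingProperty {A B X Y : LargeType.{w, u}} (i : A ⟶ B) (p : X ⟶ Y)
    (hi : cofibrations _ i) (hp : fibrations _ p) : HasLiftingProperty i p where
  sq_hasLift {u v} sq := by
    classical
    have hw (a : A) : p (u a) = v (i a) := congrFun sq.w a
    obtain ⟨s, hs⟩ := Function.Surjective.hasRightInverse hp
    -- Extend `u` over the image of the injection `i`, and use a section of `p` elsewhere.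
    let l (b : B) : X := if h : ∃ a, i a = b then u h.choose else s (v b)
    refine ⟨⟨⟨l, ?_, ?_⟩⟩⟩
    · funext a
      have h : ∃ a', i a' = i a := ⟨a, rfl⟩
      change l (i a) = u a
      simp only [l, dif_pos h]
      exact congrArg u (hi h.choose_spec)
    · funext b
      change p (l b) = v b
      by_cases h : ∃ a, i a = b
      · simp only [l, dif_pos h]
        rw [hw, h.choose_spec]
      · simp only [l, dif_neg h]
        exact hs _

instance : (cofibrations LargeType.{w, u}).HasFactorization (fibrations _) where
  nonempty_mapFactorizationData {X Y} f :=
    ⟨{ Z := of (X ⊕ Y)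
       i := Sum.inl
       p := Sum.elim f id
       fac := rfl
       hi := Sum.inl_injective
       hp := fun y => ⟨Sum.inr y, rfl⟩ }⟩

instance : (cofibrations LargeType.{w, u}).IsStableUnderRetracts where
  of_retract {X Y Z W f g} h hg x x' hx := by
    have hi (x : X) : h.i.right (f x) = g (h.i.left x) := congrFun h.i.w x |>.symm
    have hr (x : X) : h.r.left (h.i.left x) = x := congrFun h.retract_left x
    rw [← hr x, ← hr x', hg (show g (h.i.left x) = g (h.i.left x') by rw [← hi, ← hi, hx])]

instance : (fibrations LargeType.{w, u}).IsStableUnderRetracts where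
  of_retract {X Y Z W f g} h hg y := by
    have hw (z : Z) : f (h.r.left z) = h.r.right (g z) := congrFun h.r.w z
    have hr (y : Y) : h.r.right (h.i.right y) = y := congrFun h.retract_right y
    obtain ⟨z, hz⟩ := hg (h.i.right y)
    exact ⟨h.r.left z, by rw [hw, hz, hr]⟩

lemma trivialCofibrations_eq : trivialCofibrations LargeType.{w, u} = cofibrations _ :=
  inf_top_eq _

lemma trivialFibrations_eq : trivialFibrations LargeType.{w, u} = fibrations _ :=
  inf_top_eq _

instance : (weakEquivalences LargeType.{w, u}).HasTwoOutOfThreeProperty :=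
  inferInstanceAs (⊤ : MorphismProperty LargeType.{w, u}).HasTwoOutOfThreeProperty

instance : (weakEquivalences LargeType.{w, u}).IsStableUnderRetracts :=
  ⟨fun _ _ => MorphismProperty.top_apply _⟩

instance : ModelCategory LargeType.{w, u} where
  cm4a i p hi _ hp := hasLiftingProperty i p hi.mem hp.mem
  cm4b i p hi hp _ := hasLiftingProperty i p hi.mem hp.mem
  cm5a := by
    rw [trivialCofibrations_eq]
    infer_instance
  cm5b := by
    rw [trivialFibrations_eq]
    infer_instance

end LargeType

end SetModel

/-! ### Necessity of the criterion, tested on sets and their opposite. -/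

namespace ReedyCategory

section

variable {B : Type w} [SmallCategory B]

/-- The corepresentable diagram `Hom(β, -)`. -/
def corepresentable (β : B) : B ⥤ LargeType.{w, u} where
  obj b := LargeType.of (β ⟶ b)
  map g := fun τ : β ⟶ _ => τ ≫ g
  map_id _ := funext fun _ => Category.comp_id _
  map_comp _ _ := funext fun _ => (Category.assoc _ _ _).symm

/-- The diagram `Hom(-, β)`, with values in the opposite of the category of types. -/
def opRepresentable (β : B) : B ⥤ LargeType.{w, u}ᵒᵖ where
  obj b := Opposite.op (LargeType.of (b ⟶ β))
  map g := Quiver.Hom.op (fun τ : _ ⟶ β => g ≫ τ)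
  map_id _ := Quiver.Hom.unop_inj (funext fun _ => Category.id_comp _)
  map_comp _ _ := Quiver.Hom.unop_inj (funext fun _ => Category.assoc _ _ _)

/-- The map from the empty diagram. -/
def fromEmpty (F : B ⥤ LargeType.{w, u}) :
    (Functor.const B).obj (LargeType.of PEmpty.{w + 1}) ⟶ F where
  app _ := fun x : PEmpty => x.elim
  naturality _ _ _ := funext fun x : PEmpty => x.elim

/-- The map to the constant diagram on the empty type, in the opposite of the category of types. -/
def toOpEmpty (F : B ⥤ LargeType.{w, u}ᵒᵖ) :
    F ⟶ (Functor.const B).obj (Opposite.op (LargeType.of PEmpty.{w + 1})) where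
  app _ := Quiver.Hom.op fun x : PEmpty => x.elim
  naturality _ _ _ := Quiver.Hom.unop_inj (funext fun x : PEmpty => x.elim)

variable [ReedyCategory B]

/-- Unique factorization makes `Hom(β,-)`, restricted to `B^→`, a coproduct of corepresentables
indexed by the inverse morphisms out of `β`. A lift is thus fixed by free choices of preimages on
these generators. -/
lemma cofibrations_fromEmpty_corepresentable (β : B) :
    cofibrations (B ⥤ LargeType.{w, u}) (fromEmpty (corepresentable β)) := by
  refine ⟨?_, fun _ x => PEmpty.elim x⟩
  intro K L p hp
  refine ⟨fun {u v} sq => ?_⟩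
  have hs (Z : B) (σ : β ⟶ Z) : ∃ k : K.obj ⟨Z⟩, p.app ⟨Z⟩ k = v.app ⟨Z⟩ σ := (hp ⟨Z⟩).1 _
  choose s hs using hs
  let l (b : Direct B) (τ : β ⟶ b.obj) : K.obj b :=
    K.map (X := ⟨(factorization τ).Z⟩) ⟨(factorization τ).p, (factorization τ).hp⟩
      (s _ (factorization τ).i)
  -- By uniqueness `l` can be computed from any factorization, in particular from that of `τ`
  -- extended by a direct map.
  have hl {b : Direct B} {τ : β ⟶ b.obj} (d : inv.MapFactorizationData dir τ) :
      l b τ = K.map (X := ⟨d.Z⟩) ⟨d.p, d.hp⟩ (s _ d.i) := by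
    rw [(subsingleton_mapFactorizationData τ).elim d (factorization τ)]
  refine ⟨⟨⟨{ app b := l b, naturality b b' g := ?_ }, ?_, ?_⟩⟩⟩
  · funext τ
    let d := factorization (τ : β ⟶ b.obj)
    refine (hl (τ := τ ≫ g.hom) ⟨d.Z, d.i, d.p ≫ g.hom,
      (Category.assoc _ _ _).symm.trans (congrArg (· ≫ g.hom) d.fac), d.hi,
      MorphismProperty.comp_mem _ _ _ d.hp g.property⟩).trans ?_
    exact congrFun (K.map_comp (X := ⟨d.Z⟩) (Y := b) ⟨d.p, d.hp⟩ g) _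
  · ext b
    funext x
    exact PEmpty.elim x
  · ext b
    funext τ
    let d := factorization (τ : β ⟶ b.obj)
    refine (congrFun (p.naturality (X := ⟨d.Z⟩) (Y := b) ⟨d.p, d.hp⟩) (s _ d.i)).trans ?_
    refine (congrArg (L.map (X := ⟨d.Z⟩) (Y := b) ⟨d.p, d.hp⟩) (hs _ d.i)).trans ?_
    refine (congrFun (v.naturality (X := ⟨d.Z⟩) (Y := b) ⟨d.p, d.hp⟩) d.i).symm.trans ?_
    exact congrArg (v.app b) d.fac

lemma fibrations_toOpEmpty_opRepresentable (β : B) :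
    fibrations (B ⥤ LargeType.{w, u}ᵒᵖ) (toOpEmpty (opRepresentable β)) := by
  refine ⟨fun b => ?_, ?_⟩
  · rw [fibrations_op]
    exact fun x => PEmpty.elim x
  intro K L i hi
  have hi' (b) : trivialFibrations LargeType.{w, u} (i.app b).unop := by
    have := hi b
    rwa [trivialCofibrations_op] at this
  refine ⟨fun {u v} sq => ?_⟩
  have hs (Z : B) (σ : Z ⟶ β) : ∃ k : (L.obj ⟨Z⟩).unop, (i.app ⟨Z⟩).unop k = (u.app ⟨Z⟩).unop σ :=
    (hi' ⟨Z⟩).1 _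
  choose s hs using hs
  let l (b : Inverse B) (τ : b.obj ⟶ β) : (L.obj b).unop :=
    (L.map (Y := ⟨(factorization τ).Z⟩) ⟨(factorization τ).i, (factorization τ).hi⟩).unop
      (s _ (factorization τ).p)
  have hl {b : Inverse B} {τ : b.obj ⟶ β} (d : inv.MapFactorizationData dir τ) :
      l b τ = (L.map (Y := ⟨d.Z⟩) ⟨d.i, d.hi⟩).unop (s _ d.p) := by
    rw [(subsingleton_mapFactorizationData τ).elim d (factorization τ)]
  refine ⟨⟨⟨{ app b := Quiver.Hom.op (l b), naturality b b' g := Quiver.Hom.unop_inj ?_ }, ?_, ?_⟩⟩⟩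
  · funext τ
    let d := factorization (τ : b'.obj ⟶ β)
    refine Eq.symm ((hl (τ := g.hom ≫ τ) ⟨d.Z, g.hom ≫ d.i, d.p,
      (Category.assoc _ _ _).trans (congrArg (g.hom ≫ ·) d.fac),
      MorphismProperty.comp_mem _ _ _ g.property d.hi, d.hp⟩).trans ?_)
    exact congrFun (congrArg Quiver.Hom.unop (L.map_comp (Y := b') (Z := ⟨d.Z⟩) g ⟨d.i, d.hi⟩)) _
  · ext b
    refine Quiver.Hom.unop_inj (funext fun τ => ?_)
    let d := factorization (τ : b.obj ⟶ β)
    refine (congrFun (congrArg Quiver.Hom.unop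
      (i.naturality (X := b) (Y := ⟨d.Z⟩) ⟨d.i, d.hi⟩)) (s _ d.p)).symm.trans ?_
    refine (congrArg (K.map (X := b) (Y := ⟨d.Z⟩) ⟨d.i, d.hi⟩).unop (hs _ d.p)).trans ?_
    refine (congrFun (congrArg Quiver.Hom.unop
      (u.naturality (X := b) (Y := ⟨d.Z⟩) ⟨d.i, d.hi⟩)) d.p).trans ?_
    exact congrArg (u.app b).unop d.fac
  · ext b
    exact Quiver.Hom.unop_inj (funext fun x => PEmpty.elim x)

variable {A : Type w} [SmallCategory A] [ReedyCategory A] {f : A ⥤ B}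

/-- The coproduct of the corepresentable diagrams on `A^→` indexed by the objects of `(β/f)`. -/
def coprodCorepresentable (f : A ⥤ B) (β : B) : Direct A ⥤ LargeType.{w, u} where
  obj a := LargeType.of (Σ e : StructuredArrow β f, ((⟨e.right⟩ : Direct A) ⟶ a))
  map g := fun x : (Σ e : StructuredArrow β f, ((⟨e.right⟩ : Direct A) ⟶ _)) => ⟨x.1, x.2 ≫ g⟩
  map_id a := by
    funext ⟨e, g⟩
    exact congrArg (Sigma.mk e) (Category.comp_id _)
  map_comp g h := by
    funext ⟨e, g⟩
    exact congrArg (Sigma.mk e) (Category.assoc _ _ _).symm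

/-- The canonical map from `coprodCorepresentable f β` to `Hom(β, f -)`. -/
def coprodCorepresentableDesc (f : A ⥤ B) (β : B) :
    coprodCorepresentable.{w, u} f β ⟶
      (restrictDirect LargeType.{w, u} A).obj (f ⋙ corepresentable β) where
  app a := fun x : (Σ e : StructuredArrow β f, ((⟨e.right⟩ : Direct A) ⟶ a)) =>
    x.1.hom ≫ f.map x.2.hom
  naturality a a' g := by
    funext x
    refine (congrArg _ (f.map_comp _ _)).trans (Category.assoc _ _ _).symm

/-- Lifting the identity of `Hom(β,f-)` through the coproduct gives a natural section. At the
element `e` it names an object `e'` of `(β/f)` with a direct morphism to `e`. -/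
lemma hasCompatibleOver_of_isRightFibration (h : IsRightFibration.{w, u} f) (β : B) :
    HasCompatibleOver (Direct (StructuredArrow β f)) := by
  have h1 := ((h LargeType.{w, u}).cofibrations_map _
    (cofibrations_fromEmpty_corepresentable β)).1 (coprodCorepresentableDesc f β)
      -- Surjectivity: `τ` is the image of the identity of `a` in the summand indexed by `τ`.
      (fun a => ⟨fun τ => ⟨⟨StructuredArrow.mk (Y := a.obj) τ, 𝟙 a⟩,
        (congrArg _ (f.map_id _)).trans (Category.comp_id _)⟩, trivial⟩)
  have sq : CommSq (fromEmpty (coprodCorepresentable.{w, u} f β))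
      ((restrictDirect LargeType.{w, u} A).map (((Functor.whiskeringLeft A B _).obj f).map
        (fromEmpty (corepresentable β)))) (coprodCorepresentableDesc f β) (𝟙 _) := ⟨by
    ext a
    funext x
    exact PEmpty.elim x⟩
  let s (e : StructuredArrow β f) :
      (Σ e' : StructuredArrow β f, ((⟨e'.right⟩ : Direct A) ⟶ ⟨e.right⟩)) :=
    sq.lift.app ⟨e.right⟩ e.hom
  have hs (e : StructuredArrow β f) : (s e).1.hom ≫ f.map (s e).2.hom = e.hom :=
    congrFun (NatTrans.congr_app sq.fac_right ⟨e.right⟩) e.hom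
  let ψ (e : Direct (StructuredArrow β f))
      (x : Σ e' : StructuredArrow β f, ((⟨e'.right⟩ : Direct A) ⟶ ⟨e.obj.right⟩))
      (hx : x.1.hom ≫ f.map x.2.hom = e.obj.hom) : Over e :=
    Over.mk (Y := ⟨x.1⟩) ⟨StructuredArrow.homMk x.2.hom hx, x.2.property⟩
  -- Stated for arbitrary `x` and `y` so that the equality of dependent pairs can be substituted.
  have hψ ⦃e e' : Direct (StructuredArrow β f)⦄ (k : e ⟶ e') x hx y hy
      (hxy : x = ⟨y.1, y.2 ≫ ⟨k.hom.right, k.property⟩⟩) :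
      ψ e' x hx = Over.mk ((ψ e y hy).hom ≫ k) := by
    subst hxy
    rfl
  refine ⟨fun e => ψ e (s e.obj) (hs e.obj), fun e e' k => hψ k _ _ _ _ ?_⟩
  -- Since `e'.obj.hom` is `e.obj.hom` followed by the image of `k`, naturality of the section along
  -- the direct map `k` is the required compatibility.
  refine (congrArg (sq.lift.app ⟨e'.obj.right⟩) (StructuredArrow.w k.hom).symm).trans ?_
  exact congrFun (sq.lift.naturality (X := ⟨e.obj.right⟩) (Y := ⟨e'.obj.right⟩)
    ⟨k.hom.right, k.property⟩) e.obj.hom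

/-- The coproduct of the representable diagrams on `A^←` indexed by the objects of `(f/β)`, in the
opposite of the category of types. -/
def opCoprodRepresentable (f : A ⥤ B) (β : B) : Inverse A ⥤ LargeType.{w, u}ᵒᵖ where
  obj a := Opposite.op (LargeType.of (Σ e : CostructuredArrow f β, (a ⟶ (⟨e.left⟩ : Inverse A))))
  map g := Quiver.Hom.op fun x : (Σ e : CostructuredArrow f β, (_ ⟶ (⟨e.left⟩ : Inverse A))) =>
    ⟨x.1, g ≫ x.2⟩
  map_id a := by
    refine Quiver.Hom.unop_inj (funext fun ⟨e, g⟩ => ?_)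
    exact congrArg (Sigma.mk e) (Category.id_comp _)
  map_comp g h := by
    refine Quiver.Hom.unop_inj (funext fun ⟨e, k⟩ => ?_)
    exact congrArg (Sigma.mk e) (Category.assoc _ _ _)

/-- The canonical map from `Hom(f -, β)` to `opCoprodRepresentable f β`. -/
def opCoprodRepresentableLift (f : A ⥤ B) (β : B) :
    (restrictInverse LargeType.{w, u}ᵒᵖ A).obj (f ⋙ opRepresentable β) ⟶
      opCoprodRepresentable.{w, u} f β where
  app a := Quiver.Hom.op fun x : (Σ e : CostructuredArrow f β, (a ⟶ (⟨e.left⟩ : Inverse A))) =>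
    f.map x.2.hom ≫ x.1.hom
  naturality a a' g := by
    refine Quiver.Hom.unop_inj (funext fun x => ?_)
    exact ((congrArg (· ≫ _) (f.map_comp _ _)).trans (Category.assoc _ _ _)).symm

/-- In the opposite of sets, the injective fibrancy of `Hom(f-,β)` on `A^←` yields a retraction of
the canonical map; read in sets, it is a section choosing an inverse morphism out of each object of
`(f/β)`. -/
lemma hasCompatibleUnder_of_isLeftFibration (h : IsLeftFibration.{w, u} f) (β : B) :
    HasCompatibleUnder (Inverse (CostructuredArrow f β)) := by
  have h1 := ((h LargeType.{w, u}ᵒᵖ).fibrations_map _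
    (fibrations_toOpEmpty_opRepresentable β)).2 (opCoprodRepresentableLift f β) (fun a => by
      rw [trivialCofibrations_op]
      exact ⟨fun τ => ⟨⟨CostructuredArrow.mk (Y := a.obj) τ, 𝟙 a⟩,
        (congrArg (· ≫ _) (f.map_id _)).trans (Category.id_comp _)⟩, MorphismProperty.top_apply _⟩)
  have sq : CommSq (𝟙 _) (opCoprodRepresentableLift f β)
      ((restrictInverse LargeType.{w, u}ᵒᵖ A).map (((Functor.whiskeringLeft A B _).obj f).map
        (toOpEmpty (opRepresentable β)))) (toOpEmpty (opCoprodRepresentable.{w, u} f β)) := ⟨by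
    ext a
    exact Quiver.Hom.unop_inj (funext fun x => PEmpty.elim x)⟩
  let s (e : CostructuredArrow f β) :
      (Σ e' : CostructuredArrow f β, ((⟨e.left⟩ : Inverse A) ⟶ ⟨e'.left⟩)) :=
    (sq.lift.app ⟨e.left⟩).unop e.hom
  have hs (e : CostructuredArrow f β) : f.map (s e).2.hom ≫ (s e).1.hom = e.hom :=
    congrFun (congrArg Quiver.Hom.unop (NatTrans.congr_app sq.fac_left ⟨e.left⟩)) e.hom
  let ψ (e : Inverse (CostructuredArrow f β))
      (x : Σ e' : CostructuredArrow f β, ((⟨e.obj.left⟩ : Inverse A) ⟶ ⟨e'.left⟩))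
      (hx : f.map x.2.hom ≫ x.1.hom = e.obj.hom) : Under e :=
    Under.mk (Y := ⟨x.1⟩) ⟨CostructuredArrow.homMk x.2.hom hx, x.2.property⟩
  have hψ ⦃e e' : Inverse (CostructuredArrow f β)⦄ (k : e ⟶ e') x hx y hy
      (hxy : x = ⟨y.1, ⟨k.hom.left, k.property⟩ ≫ y.2⟩) :
      ψ e x hx = Under.mk (k ≫ (ψ e' y hy).hom) := by
    subst hxy
    rfl
  refine ⟨fun e => ψ e (s e.obj) (hs e.obj), fun e e' k => hψ k _ _ _ _ ?_⟩
  refine (congrArg (sq.lift.app ⟨e.obj.left⟩).unop (CostructuredArrow.w k.hom).symm).trans ?_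
  exact (congrFun (congrArg Quiver.Hom.unop (sq.lift.naturality (X := ⟨e.obj.left⟩)
    (Y := ⟨e'.obj.left⟩) ⟨k.hom.left, k.property⟩)) e'.obj.hom).symm

end

end ReedyCategory

theorem mainTheorem4 {A B : Type w} [SmallCategory A] [SmallCategory B]
    [ReedyCategory A] [ReedyCategory B] (f : A ⥤ B) (hf : ReedyCategory.IsMorphism f) :
    (ReedyCategory.IsLeftFibration.{w, u} f ↔
      ∀ β : B, ReedyCategory.IsLeftFibrant.{w, u} (CostructuredArrow f β)) ∧
    (ReedyCategory.IsRightFibration.{w, u} f ↔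
      ∀ β : B, ReedyCategory.IsRightFibrant.{w, u} (StructuredArrow β f)) := by
  refine ⟨⟨fun h β => ?_, fun h => ?_⟩, ⟨fun h β => ?_, fun h => ?_⟩⟩
  · exact ReedyCategory.isLeftFibrant_of_hasCompatibleUnder
      (ReedyCategory.hasCompatibleUnder_of_isLeftFibration h β)
  · exact ReedyCategory.isLeftFibration_of_hasCompatibleUnder hf fun β =>
      ReedyCategory.hasCompatibleUnder_costructuredArrow_mapInverse hf β
        (ReedyCategory.hasCompatibleUnder_of_costructuredArrow_star ⟨⟨⟩⟩
          (ReedyCategory.hasCompatibleUnder_of_isLeftFibration (h β) _))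
  · exact ReedyCategory.isRightFibrant_of_hasCompatibleOver
      (ReedyCategory.hasCompatibleOver_of_isRightFibration h β)
  · exact ReedyCategory.isRightFibration_of_hasCompatibleOver hf fun β =>
      ReedyCategory.hasCompatibleOver_structuredArrow_mapDirect hf β
        (ReedyCategory.hasCompatibleOver_of_structuredArrow_star ⟨⟨⟩⟩
          (ReedyCategory.hasCompatibleOver_of_isRightFibration (h β) _))
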